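/- Let $\mathbb T=\{|\xi|=1\}$ be the unit circle with normalized Lebesgue measure $m$, and let $\mu$ be a Borel probability measure on $\mathbb T$ with $\mu\neq m$. For $z\in\mathbb C\setminus\mathbb T$ and $f\in L^1(\mu)$ put $$K(f\mu)(z)=\int_{\mathbb T}\frac{f(\xi)\,d\mu(\xi)}{1-\bar\xi z},\qquad K\mu=K(1\cdot\mu),\qquad \mathcal C_{f\mu}(z)=\frac{K(f\mu)(z)}{K\mu(z)}$$ (the normalized Cauchy transform, defined wherever $K\mu(z)\ne0$), and let $\mathcal C_{\bar\xi\mu}$ be the case $f(\xi)=\bar\xi$. For a function $F$ on $\mathbb C\setminus\mathbb T$ and $\xi\in\mathbb T$ let $F^-(\xi)$ and $F^+(\xi)$ denote the non-tangential limits of $F(z)$ as $z\to\xi$ with $|z|<1$ and with $|z|>1$ respectively, that is, the limits within $\{|z|<1,\ |z-\xi|<\alpha(1-|z|)\}$, respectively $\{|z|>1,\ |z-\xi|<\alpha(|z|-1)\}$, for every $\alpha>1$. Write $[[F]](\xi)=F^-(\xi)-F^+(\xi)$, $K^\pm\mu=(K\mu)^\pm$, and let $\frac{d\mu}{dm}$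 be the density of the absolutely continuous part of $\mu$ with respect to $m$. Then for $m$-almost every $\xi\in\mathbb T$ the non-tangential limits $K^\pm\mu(\xi)$ and $\mathcal C_{\bar\xi\mu}^\pm(\xi)$ exist and are finite, $K^+\mu(\xi)\neq0$ and $K^-\mu(\xi)\ne0$, and $$[[\mathcal C_{\bar\xi\mu}]](\xi)=\frac{1}{\xi\,K^+\mu(\xi)\,K^-\mu(\xi)}\,\frac{d\mu}{dm}(\xi).$$ -/

import Mathlib

open MeasureTheory Filter Topology
open scoped ComplexConjugate

noncomputable section

namespace CauchyJump

/-- The unit circle carries its Borel σ-algebra. -/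
instance : MeasurableSpace Circle := borel Circle

instance : BorelSpace Circle := ⟨rfl⟩

/-- Lebesgue (arc length) measure on the unit circle, normalized to have total mass `1`. -/
def arcMeasure : Measure Circle :=
  (ENNReal.ofReal (2 * Real.pi))⁻¹ •
    (volume.restrict (Set.Ioc 0 (2 * Real.pi))).map Circle.exp

/-- The Cauchy transform `K(fτ)(z) = ∫ f(ξ) / (1 - ξ̄ z) dτ(ξ)`, for `z` off the unit circle. -/
def cauchyTransform (f : Circle → ℂ) (τ : Measure Circle) (z : ℂ) : ℂ :=
  ∫ ξ : Circle, f ξ / (1 - conj (ξ : ℂ) * z) ∂τ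

/-- The normalized Cauchy transform `C_{fτ} = K(fτ) / Kτ`. -/
def normalizedCauchyTransform (f : Circle → ℂ) (τ : Measure Circle) (z : ℂ) : ℂ :=
  cauchyTransform f τ z / cauchyTransform (fun _ => 1) τ z

/-- The non-tangential approach region (Stolz region) of aperture `α` at `ξ`
inside the unit disc. -/
def innerRegion (α : ℝ) (ξ : Circle) : Set ℂ :=
  {z | ‖z‖ < 1 ∧ ‖z - ξ‖ < α * (1 - ‖z‖)}

/-- The non-tangential approach region of aperture `α` at `ξ` outside the closed unit disc. -/
def outerRegion (α : ℝ) (ξ : Circle) : Set ℂ :=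
  {z | 1 < ‖z‖ ∧ ‖z - ξ‖ < α * (‖z‖ - 1)}

/-- `a` is the non-tangential limit of `F` at `ξ` from inside the unit circle. -/
def HasInnerLimit (F : ℂ → ℂ) (ξ : Circle) (a : ℂ) : Prop :=
  ∀ α : ℝ, 1 < α → Tendsto F (𝓝[innerRegion α ξ] (ξ : ℂ)) (𝓝 a)

/-- `a` is the non-tangential limit of `F` at `ξ` from outside the unit circle. -/
def HasOuterLimit (F : ℂ → ℂ) (ξ : Circle) (a : ℂ) : Prop :=
  ∀ α : ℝ, 1 < α → Tendsto F (𝓝[outerRegion α ξ] (ξ : ℂ)) (𝓝 a)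

/-- Both non-tangential limits of `F` at `ξ` exist, and the jump `[[F]](ξ)`, that is, the limit
from inside minus the limit from outside, equals `J`. -/
def HasJump (F : ℂ → ℂ) (ξ : Circle) (J : ℂ) : Prop :=
  ∃ a b : ℂ, HasInnerLimit F ξ a ∧ HasOuterLimit F ξ b ∧ a - b = J

end CauchyJump

end

noncomputable section

namespace CauchyJump

/-! Write `K` for `Kμ` and `P` for the Poisson integral of `μ`. In the disc `2 Re K - 1 = P ≥ 0`, so
`Re K ≥ 1/2` (`half_le_re_cauchyTransform`). Hence `1/(2K)` and `(K - 1)/K` are analytic and bounded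
by 1. By Fatou (`ae_exists_hasInnerLimit`) the first has non-tangential limits a.e., and by the F.
and M. Riesz uniqueness theorem (`ae_innerLimit_ne_zero`) these are a.e. nonzero; so `K` has a
finite inner limit `a ≠ 0`. The second function is not identically zero, because `K = 1` on the disc
would kill all nonzero Fourier coefficients of `μ` (`exists_cauchyTransform_ne_one`); uniqueness
again gives `a ≠ 1` a.e.

The reflection `K(z) = 1 - conj K(1/conj z)` (`cauchyTransform_eq_one_sub_conj`) turns this into the
outer limit `b = 1 - conj a`, which is nonzero because `a ≠ 1`.

Finally `K = 1 + z K(ξ̄μ)`, so the normalized transform is `(1 - 1/K)/z` and its jump is `(1/b -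
1/a)/ξ = (a - b)/(ξ a b)`. Here `a - b = 2 Re a - 1` is the boundary value of `P`, which is the
density of `μ` by Fatou's theorem for measures (`ae_tendsto_integral_poissonKernel`). -/

/-! ### Arc length on the circle and on `ℝ / 2πℤ`. -/

instance : Fact (0 < 2 * Real.pi) := ⟨Real.two_pi_pos⟩

/-- The standard identification of `ℝ / 2πℤ` with the unit circle, as a measurable equivalence. -/
def circleEquiv : AddCircle (2 * Real.pi) ≃ᵐ Circle :=
  AddCircle.homeomorphCircle'.toMeasurableEquiv

lemma circleEquiv_coe (t : ℝ) : circleEquiv (t : AddCircle (2 * Real.pi)) = Circle.exp t :=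
  AddCircle.homeomorphCircle'_apply_mk t

lemma arcMeasure_eq_map :
    arcMeasure = (ENNReal.ofReal (2 * Real.pi))⁻¹ •
      (volume : Measure (AddCircle (2 * Real.pi))).map circleEquiv := by
  have h := (AddCircle.measurePreserving_mk (2 * Real.pi) 0)
  rw [arcMeasure, ← h.map_eq, Measure.map_map circleEquiv.measurable h.measurable, zero_add]
  rfl

lemma ofReal_two_pi_inv_ne_zero : (ENNReal.ofReal (2 * Real.pi))⁻¹ ≠ 0 :=
  ENNReal.inv_ne_zero.2 ENNReal.ofReal_ne_top

lemma ofReal_two_pi_inv_ne_top : (ENNReal.ofReal (2 * Real.pi))⁻¹ ≠ ⊤ := by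
  simp [Real.pi_pos]

instance : IsProbabilityMeasure arcMeasure := by
  constructor
  rw [arcMeasure, Measure.smul_apply,
    Measure.map_apply Circle.exp.continuous.measurable MeasurableSet.univ]
  simp only [Set.preimage_univ, Measure.restrict_apply_univ, Real.volume_Ioc, sub_zero,
    smul_eq_mul]
  exact ENNReal.inv_mul_cancel (by simp [Real.pi_pos]) ENNReal.ofReal_ne_top

lemma ae_arcMeasure_iff {p : Circle → Prop} :
    (∀ᵐ ξ ∂arcMeasure, p ξ) ↔ ∀ᵐ x : AddCircle (2 * Real.pi), p (circleEquiv x) := by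
  rw [arcMeasure_eq_map, Measure.ae_ennreal_smul_measure_iff ofReal_two_pi_inv_ne_zero,
    circleEquiv.measurableEmbedding.ae_map_iff]

lemma integral_arcMeasure {E : Type*} [NormedAddCommGroup E] [NormedSpace ℝ E]
    (f : Circle → E) :
    ∫ ζ, f ζ ∂arcMeasure =
      (2 * Real.pi)⁻¹ • ∫ θ in (0 : ℝ)..2 * Real.pi, f (Circle.exp θ) := by
  rw [arcMeasure_eq_map, integral_smul_measure, circleEquiv.measurableEmbedding.integral_map,
    ← AddCircle.intervalIntegral_preimage (2 * Real.pi) 0, zero_add, ENNReal.toReal_inv,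
    ENNReal.toReal_ofReal Real.two_pi_pos.le]
  simp only [circleEquiv_coe]

lemma integral_arcMeasure_eq_circleAverage {E : Type*} [NormedAddCommGroup E] [NormedSpace ℝ E]
    (f : ℂ → E) (r : ℝ) :
    ∫ ζ : Circle, f (r * ζ) ∂arcMeasure = Real.circleAverage f 0 r := by
  rw [integral_arcMeasure, Real.circleAverage_def]
  simp [circleMap, Circle.coe_exp]

instance : NullSingletonClass arcMeasure := by
  constructor
  intro ξ
  have h : circleEquiv ⁻¹' {ξ} = Metric.closedBall (circleEquiv.symm ξ) 0 := by
    ext x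
    simp [← circleEquiv.symm_apply_eq, eq_comm]
  rw [arcMeasure_eq_map, Measure.smul_apply, circleEquiv.map_apply, h,
    AddCircle.volume_closedBall]
  simp [Real.pi_pos.le]

lemma exists_coe_eq_abs_le_pi (x : AddCircle (2 * Real.pi)) :
    ∃ t : ℝ, (t : AddCircle (2 * Real.pi)) = x ∧ |t| ≤ Real.pi := by
  obtain ⟨t, ht, rfl⟩ := (AddCircle.coe_image_Icc_eq (2 * Real.pi) (-Real.pi)).ge (Set.mem_univ x)
  exact ⟨t, rfl, abs_le.2 ⟨ht.1, by linarith [ht.2]⟩⟩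

lemma circleEquiv_add (x y : AddCircle (2 * Real.pi)) :
    circleEquiv (x + y) = circleEquiv x * circleEquiv y := by
  induction x using QuotientAddGroup.induction_on with | _ a
  induction y using QuotientAddGroup.induction_on with | _ b
  rw [← AddCircle.coe_add]
  simp only [circleEquiv_coe, Circle.exp_add]

/-- Jordan's inequality: chords are comparable to arcs. -/
lemma mul_dist_le_dist_circleEquiv (x y : AddCircle (2 * Real.pi)) :
    2 / Real.pi * dist x y ≤ dist (circleEquiv x) (circleEquiv y) := by
  obtain ⟨t, ht, htpi⟩ := exists_coe_eq_abs_le_pi (x - y)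
  have hd : dist x y = |t| := by
    rw [dist_eq_norm, ← ht, (AddCircle.norm_coe_eq_abs_iff _ Real.two_pi_pos.ne').2]
    rw [abs_of_pos Real.two_pi_pos]
    linarith
  have hx : circleEquiv x = Circle.exp t * circleEquiv y := by
    rw [← circleEquiv_coe, ← circleEquiv_add, ht, sub_add_cancel]
  have hc : dist (circleEquiv x) (circleEquiv y) = 2 * |Real.sin (t / 2)| := by
    change dist (circleEquiv x : ℂ) (circleEquiv y : ℂ) = _
    rw [dist_eq_norm, hx, Circle.coe_mul, Circle.coe_exp, ← sub_one_mul, norm_mul,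
      Circle.norm_coe, mul_one, mul_comm (t : ℂ), Complex.norm_exp_I_mul_ofReal_sub_one, norm_mul,
      Real.norm_eq_abs, Real.norm_eq_abs, abs_two]
  have h2 : |t / 2| = |t| / 2 := by rw [abs_div, abs_two]
  have h := Real.mul_abs_le_abs_sin (x := t / 2) (by rw [h2]; linarith)
  rw [hd, hc]
  rw [h2] at h
  linarith

/-! ### Differentiation of measures on the circle. -/

/-- The measure `τ` has zero density at `ξ` with respect to arc length. -/
def HasZeroDensityAt (τ : Measure Circle) (ξ : Circle) : Prop :=
  Tendsto (fun s : ℝ => τ.real (Metric.closedBall ξ s) / s) (𝓝[>] 0) (𝓝 0)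

/-- The Vitali family of closed arcs on `ℝ / 2πℤ`. -/
def arcFamily : VitaliFamily (volume : Measure (AddCircle (2 * Real.pi))) :=
  IsUnifLocDoublingMeasure.vitaliFamily volume 1

lemma preimage_closedBall_subset (x : AddCircle (2 * Real.pi)) (s : ℝ) :
    circleEquiv ⁻¹' Metric.closedBall (circleEquiv x) s ⊆
      Metric.closedBall x (Real.pi / 2 * s) := by
  intro y hy
  have h := (mul_dist_le_dist_circleEquiv y x).trans hy
  have hpi := Real.pi_pos
  rw [Metric.mem_closedBall]
  calc dist y x = Real.pi / 2 * (2 / Real.pi * dist y x) := by field_simp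
    _ ≤ Real.pi / 2 * s := by gcongr

/-- A chordal ball of radius `s` lies in an arc of radius `πs/2`, whose length is at most `πs`; so
density zero along the Vitali family passes to chordal balls. -/
lemma hasZeroDensityAt_of_tendsto {τ : Measure Circle} [IsFiniteMeasure τ]
    {x : AddCircle (2 * Real.pi)}
    (h : Tendsto (fun a => (τ.map circleEquiv.symm) a / volume a) (arcFamily.filterAt x) (𝓝 0)) :
    HasZeroDensityAt τ (circleEquiv x) := by
  set ρ := τ.map circleEquiv.symm with hρ
  have : IsFiniteMeasure ρ := by rw [hρ]; infer_instance
  have hpi := Real.pi_pos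
  have hlim : Tendsto (fun s : ℝ => Real.pi / 2 * s) (𝓝[>] 0) (𝓝[>] 0) := by
    refine tendsto_nhdsWithin_iff.2 ⟨?_, ?_⟩
    · have : Tendsto (fun s : ℝ => Real.pi / 2 * s) (𝓝 0) (𝓝 (Real.pi / 2 * 0)) :=
        (continuous_const.mul continuous_id).tendsto 0
      rw [mul_zero] at this
      exact this.mono_left nhdsWithin_le_nhds
    · filter_upwards [self_mem_nhdsWithin] with s hs
      have : (0 : ℝ) < s := hs
      exact Set.mem_Ioi.2 (by positivity)
  have hball := IsUnifLocDoublingMeasure.tendsto_closedBall_filterAt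
    (volume : Measure (AddCircle (2 * Real.pi))) (K := 1) (x := x) (fun _ => x)
    (fun s : ℝ => Real.pi / 2 * s) hlim (by
      filter_upwards [self_mem_nhdsWithin] with s hs
      have : (0 : ℝ) < s := hs
      exact Metric.mem_closedBall_self (by positivity))
  have h1 := (ENNReal.tendsto_toReal ENNReal.zero_ne_top).comp (h.comp hball)
  have h2 := h1.const_mul Real.pi
  rw [ENNReal.toReal_zero, mul_zero] at h2
  refine squeeze_zero' ?_ ?_ h2
  · filter_upwards [self_mem_nhdsWithin] with s hs
    have : (0 : ℝ) < s := hs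
    positivity
  · filter_upwards [self_mem_nhdsWithin] with s hs
    have hs0 : (0 : ℝ) < s := hs
    have hτ : τ.real (Metric.closedBall (circleEquiv x) s) ≤
        ρ.real (Metric.closedBall x (Real.pi / 2 * s)) := by
      have : τ = ρ.map circleEquiv := by rw [hρ, MeasurableEquiv.map_map_symm]
      rw [this, measureReal_def, circleEquiv.map_apply, ← measureReal_def]
      exact measureReal_mono (preimage_closedBall_subset x s)
    have hv : (volume (Metric.closedBall x (Real.pi / 2 * s))).toReal =
        min (2 * Real.pi) (Real.pi * s) := by
      rw [AddCircle.volume_closedBall, ENNReal.toReal_ofReal (by positivity)]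
      ring_nf
    have hvpos : 0 < min (2 * Real.pi) (Real.pi * s) := by positivity
    simp only [Function.comp_apply, ENNReal.toReal_div, hv]
    calc τ.real (Metric.closedBall (circleEquiv x) s) / s
        ≤ ρ.real (Metric.closedBall x (Real.pi / 2 * s)) / s := by gcongr
      _ = Real.pi * (ρ.real (Metric.closedBall x (Real.pi / 2 * s)) / (Real.pi * s)) := by
          field_simp
      _ ≤ Real.pi * (ρ.real (Metric.closedBall x (Real.pi / 2 * s)) /
            min (2 * Real.pi) (Real.pi * s)) := by
          gcongr
          exact min_le_right _ _

lemma ae_hasZeroDensityAt_of_mutuallySingular {τ : Measure Circle} [IsFiniteMeasure τ]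
    (h : τ ⟂ₘ arcMeasure) : ∀ᵐ ξ ∂arcMeasure, HasZeroDensityAt τ ξ := by
  have hs : τ.map circleEquiv.symm ⟂ₘ (volume : Measure (AddCircle (2 * Real.pi))) := by
    obtain ⟨s, hs, h1, h2⟩ := h
    refine ⟨circleEquiv ⁻¹' s, circleEquiv.measurable hs, ?_, ?_⟩
    · rw [circleEquiv.symm.map_apply]
      simpa [← Set.preimage_comp] using h1
    · rw [arcMeasure_eq_map, Measure.smul_apply, circleEquiv.map_apply, smul_eq_mul, mul_eq_zero]
        at h2
      exact h2.resolve_left ofReal_two_pi_inv_ne_zero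
  rw [ae_arcMeasure_iff]
  filter_upwards [arcFamily.ae_eventually_measure_zero_of_singular hs] with x hx
  exact hasZeroDensityAt_of_tendsto hx

/-- Almost every point is a Lebesgue point. -/
lemma ae_hasZeroDensityAt_withDensity_sub {E : Type*} [NormedAddCommGroup E] {g : Circle → E}
    (hg : Integrable g arcMeasure) :
    ∀ᵐ ξ ∂arcMeasure,
      HasZeroDensityAt (arcMeasure.withDensity fun ζ => ‖g ζ - g ξ‖ₑ) ξ := by
  have hint : Integrable (g ∘ circleEquiv) (volume : Measure (AddCircle (2 * Real.pi))) := by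
    rw [arcMeasure_eq_map] at hg
    rw [← circleEquiv.measurableEmbedding.integrable_map_iff]
    exact (integrable_smul_measure ofReal_two_pi_inv_ne_zero ofReal_two_pi_inv_ne_top).1 hg
  rw [ae_arcMeasure_iff]
  filter_upwards [arcFamily.ae_tendsto_lintegral_enorm_sub_div hint.locallyIntegrable] with x hx
  have : IsFiniteMeasure (arcMeasure.withDensity fun ζ => ‖g ζ - g (circleEquiv x)‖ₑ) :=
    isFiniteMeasure_withDensity (hg.sub (integrable_const _)).2.ne
  refine hasZeroDensityAt_of_tendsto ?_
  have h0 := ENNReal.Tendsto.const_mul hx (Or.inr ofReal_two_pi_inv_ne_top)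
  rw [mul_zero] at h0
  refine h0.congr' ?_
  filter_upwards [arcFamily.eventually_filterAt_measurableSet x] with a ha
  rw [circleEquiv.symm.map_apply,
    withDensity_apply _ (circleEquiv.symm.measurable ha), arcMeasure_eq_map, Measure.restrict_smul,
    lintegral_smul_measure, circleEquiv.measurableEmbedding.restrict_map,
    circleEquiv.measurableEmbedding.lintegral_map, ← Set.preimage_comp, smul_eq_mul, mul_div_assoc]
  simp

/-! ### Poisson kernel estimates in Stolz regions. -/

lemma poissonKernel_circle (z : ℂ) (ζ : Circle) :
    poissonKernel 0 z ζ = (1 - ‖z‖ ^ 2) / ‖(ζ : ℂ) - z‖ ^ 2 := by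
  rw [poissonKernel_def, sub_zero, sub_zero, Circle.norm_coe, one_pow]

lemma one_sub_norm_le_norm_sub (z : ℂ) (ζ : Circle) : 1 - ‖z‖ ≤ ‖(ζ : ℂ) - z‖ :=
  (Circle.norm_coe ζ).symm ▸ norm_sub_norm_le (ζ : ℂ) z

lemma norm_circle_sub_pos {z : ℂ} (hz : ‖z‖ < 1) (ζ : Circle) : 0 < ‖(ζ : ℂ) - z‖ :=
  (sub_pos.2 hz).trans_le (one_sub_norm_le_norm_sub z ζ)

lemma poissonKernel_circle_nonneg {z : ℂ} (hz : ‖z‖ < 1) (ζ : Circle) :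
    0 ≤ poissonKernel 0 z ζ := by
  rw [poissonKernel_circle]
  have : ‖z‖ ^ 2 ≤ 1 := pow_le_one₀ (norm_nonneg z) hz.le
  exact div_nonneg (sub_nonneg.2 this) (sq_nonneg _)

lemma continuous_poissonKernel_circle {z : ℂ} (hz : ‖z‖ < 1) :
    Continuous fun ζ : Circle => poissonKernel 0 z ζ := by
  simp_rw [poissonKernel_circle]
  refine Continuous.div (by fun_prop) (by fun_prop) fun ζ => ?_
  exact (pow_pos (norm_circle_sub_pos hz ζ) 2).ne'

lemma poissonKernel_circle_le {z : ℂ} (hz : ‖z‖ < 1) {ζ : Circle} {d : ℝ} (hd : 0 < d)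
    (h : d ≤ ‖(ζ : ℂ) - z‖) : poissonKernel 0 z ζ ≤ 2 * (1 - ‖z‖) / d ^ 2 := by
  rw [poissonKernel_circle]
  have h0 := norm_nonneg z
  have : 1 - ‖z‖ ^ 2 ≤ 2 * (1 - ‖z‖) := by nlinarith
  have : 0 ≤ 1 - ‖z‖ := by linarith
  gcongr

/-- Triangle inequality through `z`, with `‖z - ξ‖ ≤ α (1 - ‖z‖) ≤ α ‖ζ - z‖`. -/
lemma dist_le_of_mem_innerRegion {α : ℝ} (hα : 0 ≤ α) {ξ : Circle} {z : ℂ}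
    (hz : z ∈ innerRegion α ξ) (ζ : Circle) : dist ζ ξ ≤ (1 + α) * ‖(ζ : ℂ) - z‖ := by
  have h1 := one_sub_norm_le_norm_sub z ζ
  have h2 : dist ζ ξ ≤ ‖(ζ : ℂ) - z‖ + ‖z - ξ‖ := by
    change dist (ζ : ℂ) (ξ : ℂ) ≤ _
    rw [dist_eq_norm]
    exact norm_sub_le_norm_sub_add_norm_sub _ _ _
  have h3 := hz.2.le
  nlinarith

/-- Dyadic domination of the Poisson kernel in a Stolz region. -/
lemma exists_poissonKernel_le {α : ℝ} (hα : 0 ≤ α) {ξ : Circle} {z : ℂ}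
    (hz : z ∈ innerRegion α ξ) (ζ : Circle) :
    ∃ k : ℕ, dist ζ ξ ≤ 2 ^ k * (1 - ‖z‖) ∧
      poissonKernel 0 z ζ ≤ 8 * (1 + α) ^ 2 / (4 ^ k * (1 - ‖z‖)) := by
  set h := 1 - ‖z‖ with hh
  have hpos : 0 < h := sub_pos.2 hz.1
  have hex : ∃ k : ℕ, dist ζ ξ ≤ 2 ^ k * h := by
    obtain ⟨k, hk⟩ := pow_unbounded_of_one_lt (dist ζ ξ / h) (one_lt_two)
    exact ⟨k, ((div_lt_iff₀ hpos).1 hk).le⟩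
  classical
  -- The least admissible `k` also keeps `ζ` away: if `k ≥ 1` then `dist ζ ξ > 2 ^ (k - 1) * h`.
  -- This loss of a factor 2, squared, turns the 2 of the kernel bound into 8.
  refine ⟨Nat.find hex, Nat.find_spec hex, ?_⟩
  rcases hk : Nat.find hex with _ | k
  · refine (poissonKernel_circle_le hz.1 hpos (one_sub_norm_le_norm_sub z ζ)).trans ?_
    rw [← hh]
    have : 2 * h / h ^ 2 = 2 / h := by field_simp
    rw [this, pow_zero, one_mul]
    gcongr
    nlinarith
  · have hlt : 2 ^ k * h < dist ζ ξ := not_le.1 (Nat.find_min hex (hk ▸ Nat.lt_succ_self k))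
    have hd : 2 ^ k * h / (1 + α) ≤ ‖(ζ : ℂ) - z‖ := by
      rw [div_le_iff₀' (by positivity)]
      exact hlt.le.trans (dist_le_of_mem_innerRegion hα hz ζ)
    refine (poissonKernel_circle_le hz.1 (by positivity) hd).trans (le_of_eq ?_)
    rw [← hh]
    have h4 : (4 : ℝ) ^ k = 2 ^ k * 2 ^ k := by rw [← mul_pow]; norm_num
    rw [pow_succ 4, h4]
    field_simp
    norm_num

lemma tendsto_one_sub_norm_innerRegion (α : ℝ) (ξ : Circle) :
    Tendsto (fun z : ℂ => 1 - ‖z‖) (𝓝[innerRegion α ξ] (ξ : ℂ)) (𝓝[>] 0) := by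
  refine tendsto_nhdsWithin_iff.2 ⟨?_, ?_⟩
  · have : Tendsto (fun z : ℂ => 1 - ‖z‖) (𝓝 (ξ : ℂ)) (𝓝 (1 - ‖(ξ : ℂ)‖)) :=
      (continuous_const.sub continuous_norm).tendsto _
    rw [Circle.norm_coe, sub_self] at this
    exact this.mono_left nhdsWithin_le_nhds
  · filter_upwards [self_mem_nhdsWithin] with z hz
    exact sub_pos.2 hz.1

/-- Small radii are controlled by the density, large ones by the total mass. The bound dominates all
dyadic scales at once. -/
lemma HasZeroDensityAt.exists_bound {τ : Measure Circle} [IsFiniteMeasure τ] {ξ : Circle}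
    (h : HasZeroDensityAt τ ξ) :
    ∃ C : ℝ, ∀ s : ℝ, 0 < s → τ.real (Metric.closedBall ξ s) / s ≤ C := by
  have h1 : ∀ᶠ s : ℝ in 𝓝[>] 0, τ.real (Metric.closedBall ξ s) / s < 1 :=
    h.eventually_lt_const one_pos
  obtain ⟨δ, hδ, hsub⟩ := mem_nhdsGT_iff_exists_Ioo_subset.1 h1
  have hδ0 : (0 : ℝ) < δ := hδ
  refine ⟨max 1 (τ.real Set.univ / δ), fun s hs => ?_⟩
  rcases lt_or_ge s δ with hlt | hge
  · exact le_max_of_le_left (hsub ⟨hs, hlt⟩ : _ < (1 : ℝ)).le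
  · refine le_max_of_le_right ?_
    exact div_le_div₀ measureReal_nonneg (measureReal_mono (Set.subset_univ _)) hδ0 hge

/-- Dyadic summation: of the decay `4 ^ (-k)`, one factor `2 ^ (-k)` normalizes the mass of the ball
and the other keeps the series summable. -/
lemma lintegral_poissonKernel_le {τ : Measure Circle} [IsFiniteMeasure τ] {ξ : Circle} {C : ℝ}
    (hC : ∀ s : ℝ, 0 < s → τ.real (Metric.closedBall ξ s) / s ≤ C) {α : ℝ} (hα : 0 ≤ α) {z : ℂ}
    (hz : z ∈ innerRegion α ξ) :
    ∫⁻ ζ, ENNReal.ofReal (poissonKernel 0 z ζ) ∂τ ≤ ENNReal.ofReal (∑' k : ℕ,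
      8 * (1 + α) ^ 2 * ((1 / 2) ^ k * (τ.real (Metric.closedBall ξ (2 ^ k * (1 - ‖z‖))) /
        (2 ^ k * (1 - ‖z‖))))) := by
  set h := 1 - ‖z‖ with hh
  have hpos : 0 < h := sub_pos.2 hz.1
  have hsum : Summable fun k : ℕ => 8 * (1 + α) ^ 2 * ((1 / 2) ^ k *
      (τ.real (Metric.closedBall ξ (2 ^ k * h)) / (2 ^ k * h))) := by
    refine Summable.mul_left _ (Summable.of_nonneg_of_le (fun k => by positivity) (fun k => ?_)
      (summable_geometric_two.mul_right C))
    exact mul_le_mul_of_nonneg_left (hC _ (by positivity)) (by positivity)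
  rw [ENNReal.ofReal_tsum_of_nonneg (fun k => by positivity) hsum]
  calc ∫⁻ ζ, ENNReal.ofReal (poissonKernel 0 z ζ) ∂τ
      ≤ ∫⁻ ζ, ∑' k : ℕ, (Metric.closedBall ξ (2 ^ k * h)).indicator
          (fun _ => ENNReal.ofReal (8 * (1 + α) ^ 2 / (4 ^ k * h))) ζ ∂τ := by
        refine lintegral_mono fun ζ => ?_
        obtain ⟨k, hk1, hk2⟩ := exists_poissonKernel_le hα hz ζ
        refine le_trans ?_ (ENNReal.le_tsum k)
        rw [Set.indicator_of_mem (Metric.mem_closedBall.2 hk1)]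
        exact ENNReal.ofReal_le_ofReal hk2
    _ = ∑' k : ℕ, ENNReal.ofReal (8 * (1 + α) ^ 2 / (4 ^ k * h)) *
          τ (Metric.closedBall ξ (2 ^ k * h)) := by
        rw [lintegral_tsum fun k =>
          (measurable_const.indicator Metric.isClosed_closedBall.measurableSet).aemeasurable]
        congr with k
        rw [lintegral_indicator_const Metric.isClosed_closedBall.measurableSet]
    _ = _ := by
        congr with k
        rw [← ofReal_measureReal, ← ENNReal.ofReal_mul (by positivity)]
        congr 1
        have h4 : (4 : ℝ) ^ k = 2 ^ k * 2 ^ k := by rw [← mul_pow]; norm_num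
        rw [h4, one_div, inv_pow]
        field_simp

/-- **Fatou's theorem** for measures of zero density. -/
lemma HasZeroDensityAt.tendsto_lintegral_poissonKernel {τ : Measure Circle} [IsFiniteMeasure τ]
    {ξ : Circle} (h : HasZeroDensityAt τ ξ) {α : ℝ} (hα : 0 ≤ α) :
    Tendsto (fun z => ∫⁻ ζ, ENNReal.ofReal (poissonKernel 0 z ζ) ∂τ)
      (𝓝[innerRegion α ξ] (ξ : ℂ)) (𝓝 0) := by
  obtain ⟨C, hC⟩ := h.exists_bound
  have hlim : Tendsto (fun z : ℂ => ∑' k : ℕ, 8 * (1 + α) ^ 2 * ((1 / 2) ^ k *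
      (τ.real (Metric.closedBall ξ (2 ^ k * (1 - ‖z‖))) / (2 ^ k * (1 - ‖z‖)))))
      (𝓝[innerRegion α ξ] (ξ : ℂ)) (𝓝 (∑' _ : ℕ, (0 : ℝ))) := by
    refine tendsto_tsum_of_dominated_convergence
      (bound := fun k : ℕ => 8 * (1 + α) ^ 2 * ((1 / 2) ^ k * C))
      ((summable_geometric_two.mul_right C).mul_left _) (fun k => ?_) ?_
    · have hk : Tendsto (fun z : ℂ => 2 ^ k * (1 - ‖z‖)) (𝓝[innerRegion α ξ] (ξ : ℂ))
          (𝓝[>] 0) := by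
        have h1 := tendsto_nhdsWithin_iff.1 (tendsto_one_sub_norm_innerRegion α ξ)
        refine tendsto_nhdsWithin_iff.2 ⟨by simpa using h1.1.const_mul (2 ^ k), ?_⟩
        filter_upwards [h1.2] with z hz
        exact Set.mem_Ioi.2 (mul_pos (pow_pos two_pos k) (Set.mem_Ioi.1 hz))
      simpa using ((h.comp hk).const_mul ((1 / 2 : ℝ) ^ k)).const_mul (8 * (1 + α) ^ 2)
    · filter_upwards [self_mem_nhdsWithin] with z hz k
      have hpos : 0 < 1 - ‖z‖ := sub_pos.2 hz.1
      rw [Real.norm_of_nonneg (by positivity)]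
      have := hC (2 ^ k * (1 - ‖z‖)) (by positivity)
      gcongr
  rw [tsum_zero] at hlim
  have hlim' := ENNReal.tendsto_ofReal hlim
  rw [ENNReal.ofReal_zero] at hlim'
  refine tendsto_of_tendsto_of_tendsto_of_le_of_le' tendsto_const_nhds hlim'
    (Eventually.of_forall fun _ => zero_le) ?_
  filter_upwards [self_mem_nhdsWithin] with z hz
  exact lintegral_poissonKernel_le hC hα hz

/-! ### Poisson integrals and their boundary values. -/

/-- Dilation by `r < 1` makes the function differentiable up to the boundary, so the Poisson formula
applies. -/
lemma integral_poissonKernel_smul_comp {f : ℂ → ℂ} (hf : DifferentiableOn ℂ f (Metric.ball 0 1))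
    {r : ℝ} (hr0 : 0 ≤ r) (hr1 : r < 1) {z : ℂ} (hz : ‖z‖ < 1) :
    ∫ ζ : Circle, poissonKernel 0 z ζ • f (r * ζ) ∂arcMeasure = f (r * z) := by
  have hmaps : ∀ w ∈ Metric.closedBall (0 : ℂ) 1, (r : ℂ) * w ∈ Metric.ball (0 : ℂ) 1 := by
    intro w hw
    rw [mem_closedBall_zero_iff] at hw
    rw [mem_ball_zero_iff, norm_mul, Complex.norm_real, Real.norm_of_nonneg hr0]
    nlinarith [norm_nonneg w]
  have hd : DifferentiableOn ℂ (fun w => f (r * w)) (Metric.closedBall 0 1) :=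
    hf.comp (by fun_prop) hmaps
  have hcl : DiffContOnCl ℂ (fun w => f (r * w)) (Metric.ball 0 1) := by
    refine ⟨hd.mono Metric.ball_subset_closedBall, ?_⟩
    rw [closure_ball _ one_ne_zero]
    exact hd.continuousOn
  rw [← hcl.circleAverage_poissonKernel_smul (mem_ball_zero_iff.2 hz),
    ← integral_arcMeasure_eq_circleAverage]
  simp

lemma integral_poissonKernel {z : ℂ} (hz : ‖z‖ < 1) :
    ∫ ζ : Circle, poissonKernel 0 z ζ ∂arcMeasure = 1 := by
  have h := integral_poissonKernel_smul_comp (f := fun _ => 1) (differentiableOn_const 1) le_rfl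
    one_pos hz
  simp only [Complex.real_smul, mul_one] at h
  rw [integral_complex_ofReal] at h
  exact_mod_cast h

lemma integrable_poissonKernel (τ : Measure Circle) [IsFiniteMeasure τ] {z : ℂ} (hz : ‖z‖ < 1) :
    Integrable (fun ζ : Circle => poissonKernel 0 z ζ) τ :=
  (continuous_poissonKernel_circle hz).integrable_of_hasCompactSupport
    (HasCompactSupport.of_compactSpace _)

lemma integrable_poissonKernel_smul {E : Type*} [NormedAddCommGroup E] [NormedSpace ℝ E]
    {τ : Measure Circle} {g : Circle → E} (hg : Integrable g τ) {z : ℂ} (hz : ‖z‖ < 1) :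
    Integrable (fun ζ : Circle => poissonKernel 0 z ζ • g ζ) τ := by
  refine hg.bdd_smul (2 * (1 - ‖z‖) / (1 - ‖z‖) ^ 2)
    (continuous_poissonKernel_circle hz).aestronglyMeasurable (Eventually.of_forall fun ζ => ?_)
  rw [Real.norm_of_nonneg (poissonKernel_circle_nonneg hz ζ)]
  exact poissonKernel_circle_le hz (sub_pos.2 hz) (one_sub_norm_le_norm_sub z ζ)

/-- **Fatou's theorem** for Poisson integrals of integrable functions. -/
lemma ae_tendsto_integral_poissonKernel_smul {E : Type*} [NormedAddCommGroup E] [NormedSpace ℝ E]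
    [CompleteSpace E] {g : Circle → E} (hg : Integrable g arcMeasure) :
    ∀ᵐ ξ : Circle ∂arcMeasure, ∀ α : ℝ, 1 < α →
      Tendsto (fun z : ℂ => ∫ ζ : Circle, poissonKernel 0 z ζ • g ζ ∂arcMeasure)
        (𝓝[innerRegion α ξ] (ξ : ℂ)) (𝓝 (g ξ)) := by
  filter_upwards [ae_hasZeroDensityAt_withDensity_sub hg] with ξ hξ α hα
  have hsub : Integrable (fun ζ => g ζ - g ξ) arcMeasure := hg.sub (integrable_const _)
  have : IsFiniteMeasure (arcMeasure.withDensity fun ζ => ‖g ζ - g ξ‖ₑ) :=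
    isFiniteMeasure_withDensity hsub.2.ne
  have hlim := hξ.tendsto_lintegral_poissonKernel (zero_le_one.trans hα.le)
  rw [tendsto_iff_edist_tendsto_0]
  refine tendsto_of_tendsto_of_tendsto_of_le_of_le' tendsto_const_nhds hlim
    (Eventually.of_forall fun _ => zero_le) ?_
  filter_upwards [self_mem_nhdsWithin] with z hz
  have hz1 : ‖z‖ < 1 := hz.1
  -- The kernel has mass 1, so the error is the Poisson integral of `g - g ξ`, dominated by that of
  -- a measure of zero density at `ξ`.
  have heq : (∫ ζ : Circle, poissonKernel 0 z ζ • g ζ ∂arcMeasure) - g ξ =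
      ∫ ζ : Circle, poissonKernel 0 z ζ • (g ζ - g ξ) ∂arcMeasure := by
    simp_rw [smul_sub]
    rw [integral_sub (integrable_poissonKernel_smul hg hz1)
      ((integrable_poissonKernel arcMeasure hz1).smul_const _), integral_smul_const,
      integral_poissonKernel hz1, one_smul]
  rw [edist_eq_enorm_sub, heq, lintegral_withDensity_eq_lintegral_mul₀ hsub.1.enorm
    (continuous_poissonKernel_circle hz1).measurable.ennreal_ofReal.aemeasurable]
  refine (enorm_integral_le_lintegral_enorm _).trans (lintegral_mono fun ζ => ?_)
  rw [enorm_smul, Real.enorm_of_nonneg (poissonKernel_circle_nonneg hz1 ζ), Pi.mul_apply, mul_comm]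

/-- **Fatou's theorem** for Poisson integrals of measures. -/
lemma ae_tendsto_integral_poissonKernel (μ : Measure Circle) [IsFiniteMeasure μ] :
    ∀ᵐ ξ : Circle ∂arcMeasure, ∀ α : ℝ, 1 < α →
      Tendsto (fun z : ℂ => ∫ ζ : Circle, poissonKernel 0 z ζ ∂μ)
        (𝓝[innerRegion α ξ] (ξ : ℂ)) (𝓝 (μ.rnDeriv arcMeasure ξ).toReal) := by
  -- Lebesgue decomposition: the singular part has density zero a.e. and drops out in the limit; the
  -- absolutely continuous part is a Poisson integral of its density.
  filter_upwards [ae_hasZeroDensityAt_of_mutuallySingular (μ.mutuallySingular_singularPart arcMeasure),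
    ae_tendsto_integral_poissonKernel_smul (Measure.integrable_toReal_rnDeriv (μ := μ))]
    with ξ h1 h2 α hα
  have h3 := (ENNReal.tendsto_toReal ENNReal.zero_ne_top).comp
    (h1.tendsto_lintegral_poissonKernel (zero_le_one.trans hα.le))
  have h4 := h3.add (h2 α hα)
  rw [ENNReal.toReal_zero, zero_add] at h4
  refine h4.congr' ?_
  filter_upwards [self_mem_nhdsWithin] with z hz
  have hz1 : ‖z‖ < 1 := hz.1
  conv_rhs => rw [μ.haveLebesgueDecomposition_add arcMeasure]
  rw [integral_add_measure (integrable_poissonKernel _ hz1) (integrable_poissonKernel _ hz1),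
    integral_eq_lintegral_of_nonneg_ae
      (Eventually.of_forall fun ζ => poissonKernel_circle_nonneg hz1 ζ)
      (continuous_poissonKernel_circle hz1).aestronglyMeasurable,
    integral_withDensity_eq_integral_toReal_smul (μ.measurable_rnDeriv arcMeasure)
      (μ.rnDeriv_lt_top arcMeasure)]
  simp [mul_comm]

/-! ### Boundary limits of bounded analytic functions. -/

/-- Radii increasing to `1`. -/
def radius (n : ℕ) : ℝ := 1 - 1 / (n + 2)

lemma radius_pos (n : ℕ) : 0 < radius n := by
  have : (1 : ℝ) / (n + 2) < 1 := by
    rw [div_lt_one (by positivity)]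
    linarith [(Nat.cast_nonneg n : (0 : ℝ) ≤ n)]
  exact sub_pos.2 this

lemma radius_lt_one (n : ℕ) : radius n < 1 := sub_lt_self _ (by positivity)

/-- Keeps `log (radius n)` bounded below, which makes the Jensen bound uniform in `n`. -/
lemma half_le_radius (n : ℕ) : 1 / 2 ≤ radius n := by
  have : (1 : ℝ) / (n + 2) ≤ 1 / 2 :=
    one_div_le_one_div_of_le two_pos (by linarith [(Nat.cast_nonneg n : (0 : ℝ) ≤ n)])
  rw [radius]
  linarith

lemma tendsto_radius : Tendsto radius atTop (𝓝 1) := by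
  have h : Tendsto (fun n : ℕ => (1 : ℝ) / (n + 2)) atTop (𝓝 0) := by
    have := (tendsto_add_atTop_iff_nat 1).2 (tendsto_one_div_add_atTop_nhds_zero_nat (𝕜 := ℝ))
    refine this.congr fun n => ?_
    push_cast
    ring
  have h1 := h.const_sub 1
  rw [sub_zero] at h1
  exact h1

lemma norm_radius_mul_circle (n : ℕ) (ζ : Circle) : ‖(radius n : ℂ) * ζ‖ = radius n := by
  rw [norm_mul, Circle.norm_coe, mul_one, Complex.norm_real, Real.norm_of_nonneg (radius_pos n).le]

lemma radius_mul_circle_mem_ball (n : ℕ) (ζ : Circle) :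
    (radius n : ℂ) * ζ ∈ Metric.ball (0 : ℂ) 1 := by
  rw [mem_ball_zero_iff, norm_radius_mul_circle]
  exact radius_lt_one n

lemma continuous_comp_radius {f : ℂ → ℂ} (hf : ContinuousOn f (Metric.ball 0 1)) (n : ℕ) :
    Continuous fun ζ : Circle => f (radius n * ζ) :=
  hf.comp_continuous (by fun_prop) (radius_mul_circle_mem_ball n)

/-- A bounded analytic function on the disc is the Poisson integral of an integrable function. -/
lemma exists_integrable_poissonKernel_smul_eq {f : ℂ → ℂ}
    (hf : DifferentiableOn ℂ f (Metric.ball 0 1)) {M : ℝ}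
    (hM : ∀ z ∈ Metric.ball (0 : ℂ) 1, ‖f z‖ ≤ M) :
    ∃ g : Circle → ℂ, Integrable g arcMeasure ∧ ∀ z : ℂ, ‖z‖ < 1 →
      ∫ ζ : Circle, poissonKernel 0 z ζ • g ζ ∂arcMeasure = f z := by
  let F : ℕ → C(Circle, ℂ) := fun n => ⟨_, continuous_comp_radius hf.continuousOn n⟩
  let T := ContinuousMap.toLp (E := ℂ) 2 arcMeasure ℂ
  let Λ : ℕ → WeakDual ℂ (Lp ℂ 2 arcMeasure) := fun n =>
    StrongDual.toWeakDual (InnerProductSpace.toDual ℂ _ (T (F n)))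
  have hM0 : 0 ≤ M := (norm_nonneg _).trans (hM 0 (by simp))
  have hΛ : ∀ n, Λ n ∈ WeakDual.toStrongDual ⁻¹'
      Metric.closedBall (0 : StrongDual ℂ (Lp ℂ 2 arcMeasure)) M := by
    intro n
    rw [Set.mem_preimage, mem_closedBall_zero_iff]
    change ‖InnerProductSpace.toDual ℂ _ (T (F n))‖ ≤ M
    rw [LinearIsometryEquiv.norm_map]
    refine (Lp.norm_le_of_ae_bound hM0 ?_).trans (le_of_eq (b := M) ?_)
    · filter_upwards [ContinuousMap.coeFn_toLp (p := 2) (𝕜 := ℂ) arcMeasure (F n)] with ζ hζ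
      rw [hζ]
      exact hM _ (radius_mul_circle_mem_ball n ζ)
    · simp [measureUnivNNReal]
  -- Banach–Alaoglu along a free ultrafilter, so no subsequence has to be extracted. The weak limit
  -- of the dilates `f (radius n * ζ)` in `L²` is the boundary function; testing against the Poisson
  -- kernel recovers `f z`.
  obtain ⟨L, -, hL⟩ := (WeakDual.isCompact_closedBall 0 M).ultrafilter_le_nhds'
    (Ultrafilter.map Λ (hyperfilter ℕ)) (Ultrafilter.mem_map.2 (univ_mem' hΛ))
  have hlim : ∀ h : Lp ℂ 2 arcMeasure,
      Tendsto (fun n => inner ℂ (T (F n)) h) (hyperfilter ℕ) (𝓝 (L h)) := fun h =>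
    ((WeakDual.eval_continuous h).tendsto L).comp (show Tendsto Λ (hyperfilter ℕ) (𝓝 L) from hL)
  let g : Lp ℂ 2 arcMeasure := (InnerProductSpace.toDual ℂ _).symm (WeakDual.toStrongDual L)
  have hg : ∀ h, L h = inner ℂ g h := fun h =>
    (InnerProductSpace.toDual_symm_apply (y := WeakDual.toStrongDual L)).symm
  refine ⟨g, (Lp.memLp g).integrable one_le_two, fun z hz => ?_⟩
  let P : C(Circle, ℂ) := ⟨fun ζ => (poissonKernel 0 z ζ : ℂ),
    Complex.continuous_ofReal.comp (continuous_poissonKernel_circle hz)⟩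
  have hP : ∀ h : Lp ℂ 2 arcMeasure, inner ℂ h (T P) =
      conj (∫ ζ : Circle, poissonKernel 0 z ζ • h ζ ∂arcMeasure) := by
    intro h
    rw [L2.inner_def, ← integral_conj]
    refine integral_congr_ae ?_
    filter_upwards [ContinuousMap.coeFn_toLp (p := 2) (𝕜 := ℂ) arcMeasure P] with ζ hζ
    rw [hζ]
    simp [P, RCLike.inner_apply]
  have h1 := hlim (T P)
  rw [hg, hP] at h1
  have h2 : ∀ n, inner ℂ (T (F n)) (T P) = conj (f (radius n * z)) := by
    intro n
    rw [hP, ← integral_poissonKernel_smul_comp hf (radius_pos n).le (radius_lt_one n) hz]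
    congr 1
    refine integral_congr_ae ?_
    filter_upwards [ContinuousMap.coeFn_toLp (p := 2) (𝕜 := ℂ) arcMeasure (F n)] with ζ hζ
    rw [hζ]
    rfl
  simp_rw [h2] at h1
  have h3 : Tendsto (fun n => conj (f (radius n * z))) (hyperfilter ℕ : Filter ℕ)
      (𝓝 (conj (f z))) := by
    refine (Complex.continuous_conj.tendsto _).comp ?_
    have hc : ContinuousAt f z := hf.continuousOn.continuousAt
      (Metric.isOpen_ball.mem_nhds (mem_ball_zero_iff.2 hz))
    have hr : Tendsto (fun n => (radius n : ℂ) * z) atTop (𝓝 z) := by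
      simpa using ((Complex.continuous_ofReal.tendsto 1).comp tendsto_radius).mul_const z
    exact (hc.tendsto.comp hr).mono_left Nat.hyperfilter_le_atTop
  exact (starRingEnd ℂ).injective (tendsto_nhds_unique h1 h3)

/-- **Fatou's theorem** for bounded analytic functions. -/
lemma ae_exists_hasInnerLimit {f : ℂ → ℂ} (hf : DifferentiableOn ℂ f (Metric.ball 0 1)) {M : ℝ}
    (hM : ∀ z ∈ Metric.ball (0 : ℂ) 1, ‖f z‖ ≤ M) :
    ∀ᵐ ξ : Circle ∂arcMeasure, ∃ a, HasInnerLimit f ξ a := by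
  obtain ⟨g, hg, hgf⟩ := exists_integrable_poissonKernel_smul_eq hf hM
  filter_upwards [ae_tendsto_integral_poissonKernel_smul hg] with ξ hξ
  refine ⟨g ξ, fun α hα => (hξ α hα).congr' ?_⟩
  filter_upwards [self_mem_nhdsWithin] with z hz
  exact hgf z hz.1

lemma tendsto_radius_mul_circle (ξ : Circle) :
    Tendsto (fun n => (radius n : ℂ) * ξ) atTop (𝓝[innerRegion 2 ξ] (ξ : ℂ)) := by
  refine tendsto_nhdsWithin_iff.2 ⟨?_, Eventually.of_forall fun n => ?_⟩
  · simpa using ((Complex.continuous_ofReal.tendsto 1).comp tendsto_radius).mul_const (ξ : ℂ)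
  · have h := radius_lt_one n
    have h2 : ‖(radius n : ℂ) * ξ - ξ‖ = 1 - radius n := by
      rw [← sub_one_mul, norm_mul, Circle.norm_coe, mul_one, ← Complex.ofReal_one,
        ← Complex.ofReal_sub, Complex.norm_real, Real.norm_of_nonpos (by linarith), neg_sub]
    refine ⟨?_, ?_⟩
    · rw [norm_radius_mul_circle]
      exact h
    · rw [h2, norm_radius_mul_circle]
      linarith

lemma HasInnerLimit.tendsto_radius {f : ℂ → ℂ} {ξ : Circle} {a : ℂ} (h : HasInnerLimit f ξ a) :
    Tendsto (fun n => f (radius n * ξ)) atTop (𝓝 a) :=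
  (h 2 one_lt_two).comp (tendsto_radius_mul_circle ξ)

/-! ### Jensen's inequality and boundary uniqueness. -/

/-- By the identity theorem the zeros are isolated, and a discrete set in a hereditarily Lindelöf
space is countable. -/
lemma countable_zeros {f : ℂ → ℂ} (hf : DifferentiableOn ℂ f (Metric.ball 0 1))
    (hne : ∃ w ∈ Metric.ball (0 : ℂ) 1, f w ≠ 0) :
    {z | z ∈ Metric.ball (0 : ℂ) 1 ∧ f z = 0}.Countable := by
  have ha := hf.analyticOnNhd Metric.isOpen_ball
  refine (HereditarilyLindelofSpace.isLindelof _).countable_of_isDiscrete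
    (isDiscrete_iff_nhdsNE.2 fun z hz => ?_)
  rcases (ha z hz.1).eventually_eq_zero_or_eventually_ne_zero with h | h
  · obtain ⟨w, hw, hfw⟩ := hne
    exact absurd (ha.eqOn_zero_of_preconnected_of_eventuallyEq_zero
      (convex_ball _ _).isPreconnected hz.1 h hw) hfw
  · rw [← empty_mem_iff_bot]
    filter_upwards [h.filter_mono inf_le_left, mem_inf_of_right (mem_principal_self _)]
      with w h1 h2 using h1 h2.2

/-- Needed because `Real.log 0 = 0`: zeros at the sampled points would hide the divergence of `log
‖f‖`. -/
lemma ae_radius_mul_ne_zero {f : ℂ → ℂ} (hf : DifferentiableOn ℂ f (Metric.ball 0 1))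
    (hne : ∃ w ∈ Metric.ball (0 : ℂ) 1, f w ≠ 0) :
    ∀ᵐ ξ : Circle ∂arcMeasure, ∀ n, f (radius n * ξ) ≠ 0 := by
  rw [ae_all_iff]
  intro n
  have hinj : Function.Injective fun ξ : Circle => (radius n : ℂ) * ξ := fun a b hab =>
    Circle.ext (mul_left_cancel₀ (Complex.ofReal_ne_zero.2 (radius_pos n).ne') hab)
  refine measure_mono_null (fun ξ hξ => ?_)
    (((countable_zeros hf hne).preimage hinj).measure_zero arcMeasure)
  exact ⟨radius_mul_circle_mem_ball n ξ, not_not.1 hξ⟩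

lemma closedBall_radius_subset (n : ℕ) :
    Metric.closedBall (0 : ℂ) |radius n| ⊆ Metric.ball 0 1 := by
  rw [abs_of_pos (radius_pos n)]
  exact Metric.closedBall_subset_ball (radius_lt_one n)

/-- Jensen's inequality for the logarithm of an analytic function. -/
lemma exists_le_circleAverage_log {f : ℂ → ℂ} (hf : DifferentiableOn ℂ f (Metric.ball 0 1)) :
    ∃ C : ℝ, ∀ n, C ≤ Real.circleAverage (fun z => Real.log ‖f z‖) 0 (radius n) := by
  have ha := hf.analyticOnNhd Metric.isOpen_ball
  -- Jensen's formula with the nonnegative sum over zeros dropped and the radius replaced by its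
  -- lower bound `1 / 2`.
  refine ⟨((meromorphicOrderAt f 0).untop₀ : ℝ) * Real.log (1 / 2) +
    Real.log ‖meromorphicTrailingCoeffAt f 0‖, fun n => ?_⟩
  have hr := radius_pos n
  have han := ha.mono (closedBall_radius_subset n)
  rw [MeromorphicOn.circleAverage_log_norm hr.ne' han.meromorphicOn,
    MeromorphicOn.divisor_apply han.meromorphicOn (Metric.mem_closedBall_self (abs_nonneg _))]
  have hnonneg : 0 ≤ meromorphicOrderAt f 0 := (ha 0 (by simp)).meromorphicOrderAt_nonneg
  have hord : (0 : ℝ) ≤ ((meromorphicOrderAt f 0).untop₀ : ℝ) := by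
    exact_mod_cast WithTop.untop₀_nonneg.2 hnonneg
  have hlog : Real.log (1 / 2) ≤ Real.log (radius n) :=
    Real.log_le_log (by norm_num) (half_le_radius n)
  have hsum : 0 ≤ ∑ᶠ u, ((MeromorphicOn.divisor f (Metric.closedBall 0 |radius n|)) u : ℝ) *
      Real.log (radius n * ‖0 - u‖⁻¹) := by
    refine finsum_nonneg fun u => ?_
    by_cases hu : u ∈ Metric.closedBall (0 : ℂ) |radius n|
    · have h1 : (0 : ℝ) ≤ (MeromorphicOn.divisor f (Metric.closedBall 0 |radius n|)) u := by
        exact_mod_cast MeromorphicOn.AnalyticOnNhd.divisor_nonneg han u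
      refine mul_nonneg h1 ?_
      rw [zero_sub, norm_neg]
      -- At `u = 0` the conventions `0⁻¹ = 0` and `log 0 = 0` make the term vanish.
      rcases eq_or_ne u 0 with rfl | hu0
      · simp
      · rw [mem_closedBall_zero_iff, abs_of_pos hr] at hu
        refine Real.log_nonneg ?_
        rw [← div_eq_mul_inv, one_le_div (norm_pos_iff.2 hu0)]
        exact hu
    · rw [Function.locallyFinsuppWithin.apply_eq_zero_of_notMem _ hu]
      simp
  have := mul_le_mul_of_nonneg_left hlog hord
  linarith

lemma integrable_of_circleIntegrable {F : ℂ → ℝ} {r : ℝ} (hF : CircleIntegrable F 0 r)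
    (hm : Measurable fun ζ : Circle => F (r * ζ)) :
    Integrable (fun ζ : Circle => F (r * ζ)) arcMeasure := by
  refine Integrable.smul_measure ?_ ofReal_two_pi_inv_ne_top
  rw [integrable_map_measure hm.aestronglyMeasurable Circle.exp.continuous.aemeasurable]
  have h := hF
  rw [CircleIntegrable, intervalIntegrable_iff_integrableOn_Ioc_of_le Real.two_pi_pos.le] at h
  refine h.congr (Eventually.of_forall fun θ => ?_)
  simp [circleMap, Circle.coe_exp]

/-- **Uniqueness theorem** of F. and M. Riesz for bounded analytic functions. -/
lemma ae_innerLimit_ne_zero {f : ℂ → ℂ} (hf : DifferentiableOn ℂ f (Metric.ball 0 1))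
    (h1 : ∀ z ∈ Metric.ball (0 : ℂ) 1, ‖f z‖ ≤ 1)
    (hne : ∃ w ∈ Metric.ball (0 : ℂ) 1, f w ≠ 0) :
    ∀ᵐ ξ : Circle ∂arcMeasure, ¬ HasInnerLimit f ξ 0 := by
  obtain ⟨C, hC⟩ := exists_le_circleAverage_log hf
  have ha := hf.analyticOnNhd Metric.isOpen_ball
  have hmeas : ∀ n, Measurable fun ζ : Circle => Real.log ‖f (radius n * ζ)‖ := fun n =>
    Real.measurable_log.comp (continuous_comp_radius hf.continuousOn n).norm.measurable
  have hmeas' : ∀ n, Measurable fun ζ : Circle =>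
      ENNReal.ofReal (-Real.log ‖f (radius n * ζ)‖) := fun n => (hmeas n).neg.ennreal_ofReal
  have hbound : ∀ n, ∫⁻ ζ : Circle, ENNReal.ofReal (-Real.log ‖f (radius n * ζ)‖) ∂arcMeasure ≤
      ENNReal.ofReal (-C) := by
    intro n
    have hmer : MeromorphicOn f (Metric.sphere 0 |radius n|) := fun z hz =>
      (ha z (closedBall_radius_subset n (Metric.sphere_subset_closedBall hz))).meromorphicAt
    have hint : Integrable (fun ζ : Circle => -Real.log ‖f (radius n * ζ)‖) arcMeasure :=
      (integrable_of_circleIntegrable hmer.circleIntegrable_log_norm (hmeas n)).neg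
    rw [← ofReal_integral_eq_lintegral_ofReal hint
      (Eventually.of_forall fun ζ => neg_nonneg.2
        (Real.log_nonpos (norm_nonneg _) (h1 _ (radius_mul_circle_mem_ball n ζ))))]
    refine ENNReal.ofReal_le_ofReal ?_
    rw [integral_neg, integral_arcMeasure_eq_circleAverage (fun z => Real.log ‖f z‖)]
    exact neg_le_neg (hC n)
  -- Fatou's lemma makes the liminf of `-log ‖f‖` finite a.e.; a boundary limit 0 would make it
  -- infinite.
  have hfatou : ∫⁻ ζ : Circle, liminf (fun n =>
      ENNReal.ofReal (-Real.log ‖f (radius n * ζ)‖)) atTop ∂arcMeasure ≤ ENNReal.ofReal (-C) :=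
    (lintegral_liminf_le hmeas').trans
      (liminf_le_of_le (by isBoundedDefault) fun b hb => by
        obtain ⟨n, hn⟩ := hb.exists
        exact hn.trans (hbound n))
  have hlt := ae_lt_top (Measurable.liminf hmeas') (hfatou.trans_lt ENNReal.ofReal_lt_top).ne
  filter_upwards [hlt, ae_radius_mul_ne_zero hf hne] with ξ hξ hξ0 hlim
  have hn : Tendsto (fun n => ‖f (radius n * ξ)‖) atTop (𝓝[>] 0) :=
    tendsto_nhdsWithin_iff.2 ⟨by simpa using hlim.tendsto_radius.norm,
      Eventually.of_forall fun n => norm_pos_iff.2 (hξ0 n)⟩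
  have htop : Tendsto (fun n => ENNReal.ofReal (-Real.log ‖f (radius n * ξ)‖)) atTop (𝓝 ⊤) :=
    ENNReal.tendsto_ofReal_atTop.comp
      (tendsto_neg_atBot_atTop.comp (Real.tendsto_log_nhdsGT_zero.comp hn))
  rw [htop.liminf_eq] at hξ
  exact hξ.ne rfl

/-! ### Measures determined by Fourier coefficients. -/

/-- Integration against a finite measure on a compact space, as a continuous functional. -/
def integralFunctional {X : Type*} [TopologicalSpace X] [CompactSpace X] [MeasurableSpace X]
    [BorelSpace X] (τ : Measure X) [IsFiniteMeasure τ] : C(X, ℂ) →L[ℂ] ℂ :=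
  LinearMap.mkContinuous
    { toFun := fun f => ∫ x, f x ∂τ
      map_add' := fun f g => by
        have hi : ∀ f : C(X, ℂ), Integrable f τ := fun f =>
          f.continuous.integrable_of_hasCompactSupport (HasCompactSupport.of_compactSpace _)
        exact integral_add (hi f) (hi g)
      map_smul' := fun c f => integral_const_mul c f }
    (τ.real Set.univ) fun f => by
      rw [mul_comm]
      exact norm_integral_le_of_norm_le_const (Eventually.of_forall f.norm_coe_le_norm)

lemma integralFunctional_apply {X : Type*} [TopologicalSpace X] [CompactSpace X]
    [MeasurableSpace X] [BorelSpace X] (τ : Measure X) [IsFiniteMeasure τ] (f : C(X, ℂ)) :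
    integralFunctional τ f = ∫ x, f x ∂τ := rfl

lemma toCircle_eq_circleEquiv (x : AddCircle (2 * Real.pi)) :
    AddCircle.toCircle x = circleEquiv x := by
  induction x using QuotientAddGroup.induction_on with | _ a
  rw [circleEquiv_coe, AddCircle.toCircle_apply_mk, div_self Real.two_pi_pos.ne', one_mul]

/-- A finite measure on the circle is determined by its Fourier coefficients. -/
lemma measure_ext_of_integral_zpow {μ ν : Measure Circle} [IsFiniteMeasure μ] [IsFiniteMeasure ν]
    (h : ∀ k : ℤ, ∫ ζ : Circle, (ζ : ℂ) ^ k ∂μ = ∫ ζ : Circle, (ζ : ℂ) ^ k ∂ν) : μ = ν := by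
  suffices hmap : μ.map circleEquiv.symm = ν.map circleEquiv.symm by
    rw [← circleEquiv.map_map_symm (ν := μ), hmap, circleEquiv.map_map_symm]
  have hfourier : ∀ (τ : Measure Circle) [IsFiniteMeasure τ] (k : ℤ),
      integralFunctional (τ.map circleEquiv.symm) (fourier k) = ∫ ζ : Circle, (ζ : ℂ) ^ k ∂τ := by
    intro τ _ k
    rw [integralFunctional_apply, circleEquiv.symm.measurableEmbedding.integral_map]
    simp only [fourier_apply, AddCircle.toCircle_zsmul]
    simp only [toCircle_eq_circleEquiv, MeasurableEquiv.apply_symm_apply, Circle.coe_zpow]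
  have hdense : Dense (Submodule.span ℂ
      (Set.range (fourier (T := 2 * Real.pi))) : Set C(AddCircle (2 * Real.pi), ℂ)) := by
    rw [Submodule.dense_iff_topologicalClosure_eq_top]
    exact span_fourier_closure_eq_top
  have heq : integralFunctional (μ.map circleEquiv.symm) =
      integralFunctional (ν.map circleEquiv.symm) := by
    refine ContinuousLinearMap.ext_on hdense ?_
    rintro _ ⟨k, rfl⟩
    rw [hfourier, hfourier, h]
  refine ext_of_forall_integral_eq_of_IsFiniteMeasure fun f => ?_
  have hf := DFunLike.congr_fun heq
    ⟨fun x => (f x : ℂ), Complex.continuous_ofReal.comp f.continuous⟩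
  rw [integralFunctional_apply, integralFunctional_apply] at hf
  simp only [ContinuousMap.coe_mk] at hf
  rw [integral_complex_ofReal, integral_complex_ofReal] at hf
  exact_mod_cast hf

/-- The Poisson formula at `z = 0` is the mean value property. The radius `1 / 2` is arbitrary; its
power is a nonzero factor that cancels. -/
lemma integral_pow_succ_arcMeasure (n : ℕ) :
    ∫ ζ : Circle, (ζ : ℂ) ^ (n + 1) ∂arcMeasure = 0 := by
  have h := integral_poissonKernel_smul_comp (f := fun w => w ^ (n + 1)) (z := 0)
    (differentiableOn_id.pow (n + 1)) (r := 1 / 2) (by norm_num) (by norm_num) (by simp)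
  simp only [poissonKernel_circle, sub_zero, Circle.norm_coe, norm_zero, mul_pow, mul_zero] at h
  norm_num [integral_const_mul] at h
  exact h

lemma conj_circle (ζ : Circle) : conj (ζ : ℂ) = (ζ : ℂ)⁻¹ := by
  rw [← Circle.coe_inv, Circle.coe_inv_eq_conj]

/-- A probability measure whose nonzero Fourier coefficients vanish is arc length. -/
lemma eq_arcMeasure_of_integral_conj_pow_eq_zero {μ : Measure Circle} [IsProbabilityMeasure μ]
    (h : ∀ n : ℕ, ∫ ζ : Circle, conj (ζ : ℂ) ^ (n + 1) ∂μ = 0) : μ = arcMeasure := by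
  -- Total mass 1 fixes the coefficient at 0, and conjugation passes from negative to positive
  -- frequencies.
  have key : ∀ (τ : Measure Circle) [IsProbabilityMeasure τ],
      (∀ n : ℕ, ∫ ζ : Circle, conj (ζ : ℂ) ^ (n + 1) ∂τ = 0) →
      ∀ k : ℤ, ∫ ζ : Circle, (ζ : ℂ) ^ k ∂τ = if k = 0 then 1 else 0 := by
    intro τ _ hτ k
    rcases k with (_ | n) | n
    · simp
    · have h0 := congrArg conj (hτ n)
      rw [← integral_conj] at h0
      simp only [map_pow, Complex.conj_conj, map_zero] at h0
      rw [if_neg (by simp; omega)]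
      exact h0
    · rw [if_neg (by simp)]
      simpa only [conj_circle, inv_pow, zpow_negSucc] using hτ n
  refine measure_ext_of_integral_zpow fun k => ?_
  rw [key μ h k, key arcMeasure (fun n => ?_) k]
  have h0 := congrArg conj (integral_pow_succ_arcMeasure n)
  rw [← integral_conj] at h0
  simpa only [map_pow, map_zero] using h0

/-! ### Cauchy transforms off the circle. -/

lemma norm_one_sub_conj_mul (ζ : Circle) (z : ℂ) :
    ‖1 - conj (ζ : ℂ) * z‖ = ‖(ζ : ℂ) - z‖ := by
  have h : (ζ : ℂ) - z = ζ * (1 - conj (ζ : ℂ) * z) := by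
    rw [conj_circle, mul_sub, mul_inv_cancel_left₀ ζ.coe_ne_zero, mul_one]
  rw [h, norm_mul, Circle.norm_coe, one_mul]

lemma circle_sub_ne_zero {z : ℂ} (hz : ‖z‖ ≠ 1) (ζ : Circle) : (ζ : ℂ) - z ≠ 0 := fun h =>
  hz (by rw [← sub_eq_zero.1 h, Circle.norm_coe])

lemma one_sub_conj_mul_ne_zero {z : ℂ} (hz : ‖z‖ ≠ 1) (ζ : Circle) :
    1 - conj (ζ : ℂ) * z ≠ 0 := by
  rw [← norm_ne_zero_iff, norm_one_sub_conj_mul, norm_ne_zero_iff]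
  exact circle_sub_ne_zero hz ζ

lemma integrable_cauchyKernel {f : Circle → ℂ} (hf : Continuous f) (τ : Measure Circle)
    [IsFiniteMeasure τ] {z : ℂ} (hz : ‖z‖ ≠ 1) :
    Integrable (fun ζ : Circle => f ζ / (1 - conj (ζ : ℂ) * z)) τ := by
  refine Continuous.integrable_of_hasCompactSupport ?_ (HasCompactSupport.of_compactSpace _)
  exact hf.div (by fun_prop) (one_sub_conj_mul_ne_zero hz)

/-- Differentiation under the integral: halfway to the circle the differentiated kernel is still
bounded by `C / ε ^ 2`. -/
lemma differentiableOn_cauchyTransform {f : Circle → ℂ} (hf : Continuous f) (τ : Measure Circle)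
    [IsFiniteMeasure τ] : DifferentiableOn ℂ (cauchyTransform f τ) (Metric.ball 0 1) := by
  intro z₀ hz₀
  rw [mem_ball_zero_iff] at hz₀
  obtain ⟨C, hC⟩ := isCompact_univ.exists_bound_of_continuousOn hf.continuousOn
  set ε := (1 - ‖z₀‖) / 2 with hε
  have hε0 : 0 < ε := by rw [hε]; linarith
  have hs : ∀ z ∈ Metric.ball z₀ ε, ε ≤ 1 - ‖z‖ := by
    intro z hz
    rw [mem_ball_iff_norm] at hz
    have := norm_sub_norm_le z z₀
    linarith
  have hne : ∀ z ∈ Metric.ball z₀ ε, ‖z‖ ≠ 1 := fun z hz => by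
    have := hs z hz
    linarith
  have hz₀' := Metric.mem_ball_self (x := z₀) hε0
  refine (hasDerivAt_integral_of_dominated_loc_of_deriv_le
    (F := fun z ζ => f ζ / (1 - conj (ζ : ℂ) * z)) (bound := fun _ => C / ε ^ 2)
    (F' := fun z ζ => f ζ * conj (ζ : ℂ) / (1 - conj (ζ : ℂ) * z) ^ 2)
    (Metric.ball_mem_nhds z₀ hε0) ?_ (integrable_cauchyKernel hf τ (hne z₀ hz₀')) ?_
    (Eventually.of_forall fun ζ z hz => ?_) (integrable_const _)
    (Eventually.of_forall fun ζ z hz => ?_)).2.differentiableAt.differentiableWithinAt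
  · filter_upwards [Metric.ball_mem_nhds z₀ hε0] with z hz
    exact (integrable_cauchyKernel hf τ (hne z hz)).1
  · refine Continuous.aestronglyMeasurable ?_
    exact (hf.mul (by fun_prop)).div (by fun_prop)
      fun ζ => pow_ne_zero 2 (one_sub_conj_mul_ne_zero (hne z₀ hz₀') ζ)
  · rw [norm_div, norm_mul, norm_pow, norm_one_sub_conj_mul, RCLike.norm_conj, Circle.norm_coe,
      mul_one]
    have h1 := hC ζ (Set.mem_univ ζ)
    have h2 := (hs z hz).trans (one_sub_norm_le_norm_sub z ζ)
    have h3 := (norm_nonneg _).trans h1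
    gcongr
  · have hd : HasDerivAt (fun z => 1 - conj (ζ : ℂ) * z) (-conj (ζ : ℂ)) z := by
      simpa using ((hasDerivAt_id z).const_mul (conj (ζ : ℂ))).const_sub 1
    exact ((hasDerivAt_const z (f ζ)).div hd (one_sub_conj_mul_ne_zero (hne z hz) ζ)).congr_deriv
      (by rw [zero_mul, zero_sub, mul_neg, neg_neg])

/-- With `w = conj ζ * z` this is `2 Re (1/(1 - w)) - 1 = (1 - |w|²)/|1 - w|²`. -/
lemma two_mul_re_cauchyKernel {z : ℂ} (hz : ‖z‖ < 1) (ζ : Circle) :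
    2 * (1 / (1 - conj (ζ : ℂ) * z)).re - 1 = poissonKernel 0 z ζ := by
  have hne := one_sub_conj_mul_ne_zero hz.ne ζ
  have hn : ‖conj (ζ : ℂ) * z‖ ^ 2 = ‖z‖ ^ 2 := by
    rw [norm_mul, RCLike.norm_conj, Circle.norm_coe, one_mul]
  rw [poissonKernel_circle, ← norm_one_sub_conj_mul, ← hn, one_div, Complex.inv_re,
    ← Complex.normSq_eq_norm_sq, ← Complex.normSq_eq_norm_sq]
  have h0 := Complex.normSq_pos.2 hne
  generalize conj (ζ : ℂ) * z = w at *
  field_simp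
  simp only [Complex.normSq_apply, Complex.sub_re, Complex.sub_im, Complex.one_re, Complex.one_im]
  ring

lemma integral_poissonKernel_eq_re (μ : Measure Circle) [IsProbabilityMeasure μ] {z : ℂ}
    (hz : ‖z‖ < 1) :
    ∫ ζ : Circle, poissonKernel 0 z ζ ∂μ = 2 * (cauchyTransform (fun _ => 1) μ z).re - 1 := by
  have hi := integrable_cauchyKernel (f := fun _ => 1) continuous_const μ hz.ne
  have hre : Integrable (fun ζ : Circle => (1 / (1 - conj (ζ : ℂ) * z)).re) μ := hi.re
  have h : ∫ ζ : Circle, (1 / (1 - conj (ζ : ℂ) * z)).re ∂μ =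
      (cauchyTransform (fun _ => 1) μ z).re := integral_re hi
  simp_rw [← two_mul_re_cauchyKernel hz]
  rw [integral_sub (hre.const_mul 2) (integrable_const _), integral_const_mul, h]
  simp

lemma half_le_re_cauchyTransform (μ : Measure Circle) [IsProbabilityMeasure μ] {z : ℂ}
    (hz : ‖z‖ < 1) : 1 / 2 ≤ (cauchyTransform (fun _ => 1) μ z).re := by
  have h := integral_poissonKernel_eq_re μ hz
  have h0 : 0 ≤ ∫ ζ : Circle, poissonKernel 0 z ζ ∂μ :=
    integral_nonneg fun ζ => poissonKernel_circle_nonneg hz ζ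
  linarith

/-- Pointwise in `ζ` this is `1/(1 - w) + 1/(1 - 1/w) = 1` with `w = conj ζ * z`, integrated against
mass 1. -/
lemma cauchyTransform_eq_one_sub_conj (μ : Measure Circle) [IsProbabilityMeasure μ] {z : ℂ}
    (hz : 1 < ‖z‖) :
    cauchyTransform (fun _ => 1) μ z =
      1 - conj (cauchyTransform (fun _ => 1) μ (conj z)⁻¹) := by
  have hz0 : z ≠ 0 := norm_pos_iff.1 (one_pos.trans hz)
  have hw : ‖(conj z)⁻¹‖ ≠ 1 := by
    rw [norm_inv, RCLike.norm_conj]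
    exact (inv_lt_one_of_one_lt₀ hz).ne
  have hi := integrable_cauchyKernel (f := fun _ => 1) continuous_const μ hw
  have hi' : Integrable (fun ζ : Circle => conj (1 / (1 - conj (ζ : ℂ) * (conj z)⁻¹))) μ :=
    Complex.conjCLE.toContinuousLinearMap.integrable_comp hi
  have h1 : ∫ _ : Circle, (1 : ℂ) ∂μ = 1 := by simp
  rw [cauchyTransform, cauchyTransform, ← integral_conj, ← h1,
    ← integral_sub (integrable_const _) (h1.symm ▸ hi')]
  refine integral_congr_ae (Eventually.of_forall fun ζ => ?_)
  have hζ := ζ.coe_ne_zero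
  have hsub := circle_sub_ne_zero hz.ne' ζ
  have hsub' : z - (ζ : ℂ) ≠ 0 := by rw [← neg_sub]; exact neg_ne_zero.2 hsub
  have e1 : 1 - conj (ζ : ℂ) * z = ((ζ : ℂ) - z) / ζ := by
    rw [conj_circle]; field_simp
  have e2 : 1 - (ζ : ℂ) * z⁻¹ = (z - ζ) / z := by field_simp
  simp only [h1, map_div₀, map_one, map_sub, map_mul, map_inv₀, Complex.conj_conj]
  rw [e1, e2, one_div_div, one_div_div, ← neg_sub (ζ : ℂ) z, div_neg, sub_neg_eq_add]
  field_simp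
  ring

/-- From `1/(1 - w) = 1 + w/(1 - w)`. The case `n = 0` gives the numerator of the normalized
transform; iteration reads off the Fourier coefficients. -/
lemma cauchyTransform_conj_pow (μ : Measure Circle) [IsFiniteMeasure μ] (n : ℕ) {z : ℂ}
    (hz : ‖z‖ ≠ 1) :
    cauchyTransform (fun ζ => conj (ζ : ℂ) ^ n) μ z =
      ∫ ζ : Circle, conj (ζ : ℂ) ^ n ∂μ +
        z * cauchyTransform (fun ζ => conj (ζ : ℂ) ^ (n + 1)) μ z := by
  have hi : Integrable (fun ζ : Circle => conj (ζ : ℂ) ^ n) μ :=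
    Continuous.integrable_of_hasCompactSupport (by fun_prop) (HasCompactSupport.of_compactSpace _)
  have hi' := integrable_cauchyKernel (f := fun ζ => conj (ζ : ℂ) ^ (n + 1)) (by fun_prop) μ hz
  rw [cauchyTransform, cauchyTransform, ← integral_const_mul, ← integral_add hi (hi'.const_mul z)]
  refine integral_congr_ae (Eventually.of_forall fun ζ => ?_)
  have := one_sub_conj_mul_ne_zero hz ζ
  simp only
  field_simp
  ring

lemma cauchyTransform_conj (μ : Measure Circle) [IsProbabilityMeasure μ] {z : ℂ}
    (hz : ‖z‖ ≠ 1) :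
    cauchyTransform (fun _ => 1) μ z = 1 + z * cauchyTransform (fun ζ => conj (ζ : ℂ)) μ z := by
  simpa using cauchyTransform_conj_pow μ 0 hz

lemma cauchyTransform_zero (f : Circle → ℂ) (μ : Measure Circle) :
    cauchyTransform f μ 0 = ∫ ζ, f ζ ∂μ := by
  simp [cauchyTransform]

/-- Only arc length has constant Cauchy transform on the disc. -/
lemma exists_cauchyTransform_ne_one {μ : Measure Circle} [IsProbabilityMeasure μ]
    (hμ : μ ≠ arcMeasure) :
    ∃ w ∈ Metric.ball (0 : ℂ) 1, cauchyTransform (fun _ => 1) μ w ≠ 1 := by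
  by_contra! hcon
  -- If the `n`-th transform is constant, the recursion leaves `z` times the next one equal to 0;
  -- continuity covers `z = 0`.
  have hstep : ∀ n : ℕ, (∀ z ∈ Metric.ball (0 : ℂ) 1,
      cauchyTransform (fun ζ => conj (ζ : ℂ) ^ n) μ z = ∫ ζ : Circle, conj (ζ : ℂ) ^ n ∂μ) →
      ∀ z ∈ Metric.ball (0 : ℂ) 1,
        cauchyTransform (fun ζ => conj (ζ : ℂ) ^ (n + 1)) μ z = 0 := by
    intro n hn
    have hne : ∀ z ∈ Metric.ball (0 : ℂ) 1, z ≠ 0 →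
        cauchyTransform (fun ζ => conj (ζ : ℂ) ^ (n + 1)) μ z = 0 := by
      intro z hz hz0
      have h := cauchyTransform_conj_pow μ n (mem_ball_zero_iff.1 hz).ne
      rw [hn z hz, left_eq_add] at h
      exact (mul_eq_zero.1 h).resolve_left hz0
    intro z hz
    rcases eq_or_ne z 0 with rfl | hz0
    · have hc : ContinuousAt (cauchyTransform (fun ζ => conj (ζ : ℂ) ^ (n + 1)) μ) 0 :=
        (differentiableOn_cauchyTransform (by fun_prop) μ).continuousOn.continuousAt
          (Metric.isOpen_ball.mem_nhds hz)
      refine tendsto_nhds_unique (l := 𝓝[≠] 0) (hc.tendsto.mono_left nhdsWithin_le_nhds)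
        (tendsto_const_nhds.congr' ?_)
      filter_upwards [self_mem_nhdsWithin,
        mem_nhdsWithin_of_mem_nhds (Metric.isOpen_ball.mem_nhds hz)] with w h1 h2
      exact (hne w h2 h1).symm
    · exact hne z hz hz0
  have hzero : ∀ n : ℕ, ∀ z ∈ Metric.ball (0 : ℂ) 1,
      cauchyTransform (fun ζ => conj (ζ : ℂ) ^ (n + 1)) μ z = 0 := by
    intro n
    induction n with
    | zero => exact hstep 0 fun z hz => by simpa using hcon z hz
    | succ n ih =>
      refine hstep (n + 1) fun z hz => ?_
      rw [ih z hz, ← cauchyTransform_zero, ih 0 (by simp)]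
  refine hμ (eq_arcMeasure_of_integral_conj_pow_eq_zero fun n => ?_)
  rw [← cauchyTransform_zero, hzero n 0 (by simp)]

/-! ### Boundary limits of Cauchy transforms from both sides. -/

/-- Reflection divides both the distance to `ξ` and the distance to the circle by `‖z‖`, so the
aperture is preserved. -/
lemma conj_inv_mem_innerRegion {α : ℝ} {ξ : Circle} {z : ℂ} (hz : z ∈ outerRegion α ξ) :
    (conj z)⁻¹ ∈ innerRegion α ξ := by
  obtain ⟨h1, h2⟩ := hz
  have hpos : 0 < ‖z‖ := one_pos.trans h1
  have hz0 : z ≠ 0 := norm_pos_iff.1 hpos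
  have hn : ‖(conj z)⁻¹‖ = ‖z‖⁻¹ := by rw [norm_inv, RCLike.norm_conj]
  refine ⟨by rw [hn]; exact inv_lt_one_of_one_lt₀ h1, ?_⟩
  have hd : ‖(conj z)⁻¹ - (ξ : ℂ)‖ = ‖z - ξ‖ / ‖z‖ := by
    have hξ := ξ.coe_ne_zero
    have e : (conj z)⁻¹ - (ξ : ℂ) = conj ((ξ - z) / (z * ξ)) := by
      have hc : conj z ≠ 0 := (map_ne_zero _).2 hz0
      rw [map_div₀, map_sub, map_mul, conj_circle]
      field_simp
    rw [e, RCLike.norm_conj, norm_div, norm_mul, Circle.norm_coe, mul_one, norm_sub_rev]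
  rw [hd, hn, div_lt_iff₀ hpos]
  calc ‖z - ξ‖ < α * (‖z‖ - 1) := h2
    _ = α * (1 - ‖z‖⁻¹) * ‖z‖ := by field_simp

lemma tendsto_conj_inv (α : ℝ) (ξ : Circle) :
    Tendsto (fun z : ℂ => (conj z)⁻¹) (𝓝[outerRegion α ξ] (ξ : ℂ))
      (𝓝[innerRegion α ξ] (ξ : ℂ)) := by
  refine tendsto_nhdsWithin_iff.2 ⟨?_, ?_⟩
  · have hc : ContinuousAt (fun z : ℂ => (conj z)⁻¹) (ξ : ℂ) :=
      Complex.continuous_conj.continuousAt.inv₀ ((map_ne_zero _).2 ξ.coe_ne_zero)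
    have h := hc.tendsto
    rw [conj_circle, inv_inv] at h
    exact h.mono_left nhdsWithin_le_nhds
  · filter_upwards [self_mem_nhdsWithin] with z hz using conj_inv_mem_innerRegion hz

lemma HasInnerLimit.hasOuterLimit_cauchyTransform {μ : Measure Circle} [IsProbabilityMeasure μ]
    {ξ : Circle} {a : ℂ} (h : HasInnerLimit (cauchyTransform (fun _ => 1) μ) ξ a) :
    HasOuterLimit (cauchyTransform (fun _ => 1) μ) ξ (1 - conj a) := by
  intro α hα
  have h1 := ((Complex.continuous_conj.tendsto a).comp
    ((h α hα).comp (tendsto_conj_inv α ξ))).const_sub 1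
  refine h1.congr' ?_
  filter_upwards [self_mem_nhdsWithin] with z hz
  exact (cauchyTransform_eq_one_sub_conj μ hz.1).symm

/-- The limits of the normalized Cauchy transform of `ζ ↦ conj ζ` follow from those of `Kμ`. -/
lemma tendsto_normalizedCauchyTransform_conj {μ : Measure Circle} [IsProbabilityMeasure μ]
    {ξ : Circle} {s : Set ℂ} (hs : ∀ z ∈ s, ‖z‖ ≠ 1) {a : ℂ} (ha : a ≠ 0)
    (h : Tendsto (cauchyTransform (fun _ => 1) μ) (𝓝[s] (ξ : ℂ)) (𝓝 a)) :
    Tendsto (normalizedCauchyTransform (fun ζ => conj (ζ : ℂ)) μ) (𝓝[s] (ξ : ℂ))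
      (𝓝 ((a - 1) / ξ / a)) := by
  have hid : Tendsto (fun z : ℂ => z) (𝓝[s] (ξ : ℂ)) (𝓝 (ξ : ℂ)) :=
    tendsto_id.mono_left nhdsWithin_le_nhds
  refine (((h.sub_const 1).div hid ξ.coe_ne_zero).div h ha).congr' ?_
  filter_upwards [self_mem_nhdsWithin, hid.eventually_ne ξ.coe_ne_zero] with z hz hz0
  have hK := cauchyTransform_conj μ (hs z hz)
  change (cauchyTransform (fun _ => 1) μ z - 1) / z / cauchyTransform (fun _ => 1) μ z =
    cauchyTransform (fun ζ => conj (ζ : ℂ)) μ z / cauchyTransform (fun _ => 1) μ z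
  congr 1
  rw [hK, add_sub_cancel_left, mul_div_cancel_left₀ _ hz0]

/-- Almost everywhere, the Cauchy transform has an inner non-tangential limit, different from `1`
unless the measure is arc length. -/
lemma ae_exists_hasInnerLimit_cauchyTransform {μ : Measure Circle} [IsProbabilityMeasure μ]
    (hμ : μ ≠ arcMeasure) :
    ∀ᵐ ξ : Circle ∂arcMeasure, ∃ a : ℂ,
      HasInnerLimit (cauchyTransform (fun _ => 1) μ) ξ a ∧ a ≠ 0 ∧ a ≠ 1 := by
  set K := cauchyTransform (fun _ => 1) μ with hK
  have hre : ∀ z ∈ Metric.ball (0 : ℂ) 1, 1 / 2 ≤ (K z).re := fun z hz =>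
    half_le_re_cauchyTransform μ (mem_ball_zero_iff.1 hz)
  have hnorm : ∀ z ∈ Metric.ball (0 : ℂ) 1, 1 / 2 ≤ ‖K z‖ := fun z hz =>
    (hre z hz).trans (Complex.re_le_norm _)
  have hK0 : ∀ z ∈ Metric.ball (0 : ℂ) 1, K z ≠ 0 := fun z hz =>
    norm_pos_iff.1 (one_half_pos.trans_le (hnorm z hz))
  have hdiff : DifferentiableOn ℂ K (Metric.ball 0 1) :=
    differentiableOn_cauchyTransform continuous_const μ
  have hψd : DifferentiableOn ℂ (fun z => (2 * K z)⁻¹) (Metric.ball 0 1) :=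
    (hdiff.const_mul 2).inv fun z hz => mul_ne_zero two_ne_zero (hK0 z hz)
  have hψ1 : ∀ z ∈ Metric.ball (0 : ℂ) 1, ‖(2 * K z)⁻¹‖ ≤ 1 := by
    intro z hz
    rw [norm_inv, norm_mul, Complex.norm_ofNat]
    exact inv_le_one_of_one_le₀ (by linarith [hnorm z hz])
  have hφd : DifferentiableOn ℂ (fun z => 1 - 2 * (2 * K z)⁻¹) (Metric.ball 0 1) :=
    (hψd.const_mul 2).const_sub 1
  have hφeq : ∀ z ∈ Metric.ball (0 : ℂ) 1, 1 - 2 * (2 * K z)⁻¹ = (K z - 1) / K z := by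
    intro z hz
    have := hK0 z hz
    field_simp
  have hφ1 : ∀ z ∈ Metric.ball (0 : ℂ) 1, ‖1 - 2 * (2 * K z)⁻¹‖ ≤ 1 := by
    intro z hz
    rw [hφeq z hz, norm_div]
    refine div_le_one_of_le₀ ?_ (norm_nonneg _)
    rw [← sq_le_sq₀ (norm_nonneg _) (norm_nonneg _), ← Complex.normSq_eq_norm_sq,
      ← Complex.normSq_eq_norm_sq, Complex.normSq_apply, Complex.normSq_apply, Complex.sub_re,
      Complex.sub_im, Complex.one_re, Complex.one_im]
    -- `|K - 1| ≤ |K|` is equivalent to `Re K ≥ 1/2`.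
    nlinarith [hre z hz]
  obtain ⟨w, hw, hw1⟩ := exists_cauchyTransform_ne_one hμ
  filter_upwards [ae_exists_hasInnerLimit hψd hψ1,
    ae_innerLimit_ne_zero hψd hψ1
      ⟨0, by simp, inv_ne_zero (mul_ne_zero two_ne_zero (hK0 0 (by simp)))⟩,
    ae_innerLimit_ne_zero hφd hφ1
      ⟨w, hw, by rw [hφeq w hw]; exact div_ne_zero (sub_ne_zero.2 hw1) (hK0 w hw)⟩]
    with ξ ⟨b, hb⟩ hψ hφ
  have hb0 : b ≠ 0 := fun h => hψ (h ▸ hb)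
  refine ⟨(2 * b)⁻¹, fun α hα => ?_, inv_ne_zero (mul_ne_zero two_ne_zero hb0), fun h => hφ ?_⟩
  · refine (((hb α hα).const_mul 2).inv₀ (mul_ne_zero two_ne_zero hb0)).congr fun z => ?_
    rw [mul_inv, inv_inv, ← mul_assoc, inv_mul_cancel₀ two_ne_zero, one_mul]
  · intro α hα
    have := ((hb α hα).const_mul 2).const_sub 1
    rwa [inv_eq_one.1 h, sub_self] at this

end CauchyJump

end

/-! ### The jump formula. -/

theorem mainTheorem6 (μ : Measure Circle) [IsProbabilityMeasure μ]
    (hμ : μ ≠ CauchyJump.arcMeasure) :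
    ∀ᵐ ξ : Circle ∂CauchyJump.arcMeasure, ∃ Kplus Kminus : ℂ,
      CauchyJump.HasOuterLimit (CauchyJump.cauchyTransform (fun _ => 1) μ) ξ Kplus ∧
      CauchyJump.HasInnerLimit (CauchyJump.cauchyTransform (fun _ => 1) μ) ξ Kminus ∧
      Kplus ≠ 0 ∧ Kminus ≠ 0 ∧
      CauchyJump.HasJump
        (CauchyJump.normalizedCauchyTransform (fun ζ => conj (ζ : ℂ)) μ) ξ
        (1 / ((ξ : ℂ) * Kplus * Kminus) *
          ((μ.rnDeriv CauchyJump.arcMeasure ξ).toReal : ℂ)) := by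
  filter_upwards [CauchyJump.ae_exists_hasInnerLimit_cauchyTransform hμ,
    CauchyJump.ae_tendsto_integral_poissonKernel μ] with ξ ⟨a, ha, ha0, ha1⟩ hP
  have hout := ha.hasOuterLimit_cauchyTransform
  have hb0 : 1 - conj a ≠ 0 := by
    intro h
    have h1 := congrArg conj (sub_eq_zero.1 h)
    rw [Complex.conj_conj, map_one] at h1
    exact ha1 h1.symm
  have hPa : Tendsto (fun n => ∫ ζ : Circle, poissonKernel 0 (CauchyJump.radius n * ξ) ζ ∂μ) atTop
      (𝓝 (2 * a.re - 1)) := by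
    have h := (((Complex.continuous_re.tendsto a).comp ha.tendsto_radius).const_mul 2).sub_const 1
    refine h.congr fun n => ?_
    exact (CauchyJump.integral_poissonKernel_eq_re μ
      (mem_ball_zero_iff.1 (CauchyJump.radius_mul_circle_mem_ball n ξ))).symm
  -- Both sides are the limit of the Poisson integral of `μ` along the same radial sequence.
  have hw : (μ.rnDeriv CauchyJump.arcMeasure ξ).toReal = 2 * a.re - 1 :=
    tendsto_nhds_unique ((hP 2 one_lt_two).comp (CauchyJump.tendsto_radius_mul_circle ξ)) hPa
  refine ⟨1 - conj a, a, hout, ha, hb0, ha0, (a - 1) / ξ / a,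
    (1 - conj a - 1) / ξ / (1 - conj a),
    fun α hα => CauchyJump.tendsto_normalizedCauchyTransform_conj (fun z hz => hz.1.ne) ha0
      (ha α hα),
    fun α hα => CauchyJump.tendsto_normalizedCauchyTransform_conj (fun z hz => hz.1.ne') hb0
      (hout α hα), ?_⟩
  have hξ := ξ.coe_ne_zero
  -- This is `a - (1 - conj a)`, the jump of `Kμ` itself.
  have hsum : ((2 * a.re - 1 : ℝ) : ℂ) = a + conj a - 1 := by
    rw [Complex.add_conj]
    push_cast
    ring
  rw [hw, hsum]
  field_simp
  ring
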